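/- **Definitions.** A *symmetric monoidal $\dagger$-category* is a symmetric monoidal category with an identity-on-objects involutive contravariant functor $\dagger$ satisfying $(f\otimes g)^\dagger=f^\dagger\otimes g^\dagger$, whose associators, unitors and symmetries are unitary ($f^{-1}=f^\dagger$). A *strong symmetric monoidal $\dagger$-equivalence* is a strong symmetric monoidal functor that preserves $\dagger$, has unitary structure isomorphisms, is full and faithful, and is essentially surjective up to unitary isomorphism. $\mathbf{Hilb}$ is the symmetric monoidal $\dagger$-category of finite-dimensional complex Hilbert spaces and continuous linear maps, with the Hilbert space tensor product and adjoints; for a groupoid $\mathbf G$ (finite means finitely many objects and morphisms), $\mathbf{Hilb}^{\mathbf G}$ is the category of functors $A:\mathbf G\to\mathbf{Hilb}$ with $A(g^{-1})=A(g)^\dagger$ for all $g$ and natural transformations between them, with pointwise structure. A *finite quantum Boolean topos* is a symmetric monoidal $\dagger$-category that admits a strong symmetric monoidal $\dagger$-equivalence to $\mathbf{Hilb}^{\mathbf G}$ for some finite groupoid $\mathbf G$. A *finite Boolean topos* is a category equivalent to the functor category $\mathbf{FinSet}^{\mathbf G}$ for some finite groupoid $\mathbf G$. Let $\mathbf Q$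 be a symmetric monoidal $\dagger$-category with a chosen dual $A^*$ for every object $A$, with duality morphisms $\epsilon_A:I\to A^*\otimes A$ and $\eta_A:A\otimes A^*\to I$. A *classical structure* in $\mathbf Q$ is a commutative monoid $(A,m,u)$ with $(\mathrm{id}_A\otimes m)\circ(m^\dagger\otimes \mathrm{id}_A)=m^\dagger\circ m=(m\otimes \mathrm{id}_A)\circ(\mathrm{id}_A\otimes m^\dagger)$; its *involution* is $s_A=(\mathrm{id}_{A^*}\otimes(u^\dagger\circ m))\circ(\epsilon_A\otimes\mathrm{id}_A):A\to A^*$. The category $\mathcal C(\mathbf Q)$ has the classical structures as objects and as morphisms the monoid homomorphisms $f:A\to B$ with $s_B\circ f=f_*\circ s_A$, where $f_*=(f^\dagger)^*:A^*\to B^*$. **Theorem.** 1. Let $\mathbf Q$ be a finite quantum Boolean topos. Then every object of $\mathbf Q$ has a dual, and for any choice of duals $\mathcal C(\mathbf Q)^{\mathrm{op}}$ is a finite Boolean topos. More precisely, if $\mathbf Q$ is strongly symmetric monoidally $\dagger$-equivalent to $\mathbf{Hilb}^{\mathbf G}$ for a finite groupoid $\mathbf G$, then $\mathcal C(\mathbf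 Q)^{\mathrm{op}}\simeq\mathbf{FinSet}^{\mathbf G}$. 2. For every finite groupoid $\mathbf G$, $\mathbf{Hilb}^{\mathbf G}$ is a finite quantum Boolean topos and $\mathcal C(\mathbf{Hilb}^{\mathbf G})^{\mathrm{op}}\simeq\mathbf{FinSet}^{\mathbf G}$. 3. Every finite Boolean topos arises in this way: for every finite Boolean topos $\mathbf T$ there is a finite quantum Boolean topos of the form $\mathbf{Hilb}^{\mathbf G}$, with $\mathbf G$ a finite groupoid, such that $\mathcal C(\mathbf{Hilb}^{\mathbf G})^{\mathrm{op}}\simeq\mathbf T$. -/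

import Mathlib

open CategoryTheory MonoidalCategory

universe v u v' u'

namespace QuantumTopos

/-! ### Dagger categories -/

/-- A dagger category: a category with an involutive contravariant endofunctor that is the
identity on objects. -/
class DaggerCategory (C : Type u) [Category.{v} C] where
  /-- the adjoint of a morphism -/
  dag : ∀ {X Y : C}, (X ⟶ Y) → (Y ⟶ X)
  dag_id : ∀ X : C, dag (𝟙 X) = 𝟙 X
  dag_comp : ∀ {X Y Z : C} (f : X ⟶ Y) (g : Y ⟶ Z), dag (f ≫ g) = dag g ≫ dag f
  dag_dag : ∀ {X Y : C} (f : X ⟶ Y), dag (dag f) = f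

open DaggerCategory

/-- A morphism of a dagger category is unitary if its adjoint is a two-sided inverse. -/
def IsUnitary {C : Type u} [Category.{v} C] [DaggerCategory C] {X Y : C} (f : X ⟶ Y) : Prop :=
  f ≫ dag f = 𝟙 X ∧ dag f ≫ f = 𝟙 Y

/-- A symmetric monoidal dagger category: the tensor product is compatible with the dagger, and
the associators, the unitors and the symmetries are unitary. -/
class SymmetricMonoidalDaggerCategory (C : Type u) [Category.{v} C] [MonoidalCategory C]
    [SymmetricCategory C] [DaggerCategory C] : Prop where
  dag_tensor : ∀ {W X Y Z : C} (f : W ⟶ X) (g : Y ⟶ Z), dag (f ⊗ₘ g) = dag f ⊗ₘ dag g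
  unitary_associator : ∀ X Y Z : C, IsUnitary (α_ X Y Z).hom
  unitary_leftUnitor : ∀ X : C, IsUnitary (λ_ X).hom
  unitary_rightUnitor : ∀ X : C, IsUnitary (ρ_ X).hom
  unitary_braiding : ∀ X Y : C, IsUnitary (β_ X Y).hom

/-- A strong symmetric monoidal functor is a (strong symmetric monoidal) dagger equivalence if it
commutes with the daggers, has unitary structure morphisms, is full and faithful, and hits every
object of the target up to a unitary isomorphism. -/
structure IsDaggerEquivalence {C : Type u} {D : Type u'} [Category.{v} C] [Category.{v'} D]
    [MonoidalCategory C] [SymmetricCategory C] [DaggerCategory C]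
    [MonoidalCategory D] [SymmetricCategory D] [DaggerCategory D]
    (F : C ⥤ D) [F.Braided] : Prop where
  map_dag : ∀ {X Y : C} (f : X ⟶ Y), F.map (dag f) = dag (F.map f)
  unitary_ε : IsUnitary (Functor.LaxMonoidal.ε F)
  unitary_μ : ∀ X Y : C, IsUnitary (Functor.LaxMonoidal.μ F X Y)
  full : F.Full
  faithful : F.Faithful
  unitarily_essSurj : ∀ Y : D, ∃ (X : C) (f : F.obj X ⟶ Y), IsUnitary f

/-! ### Classical structures -/

section ClassicalStructures

open scoped MonObj

variable {C : Type u} [Category.{v} C] [MonoidalCategory C] [DaggerCategory C]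

/-- A monoid `(A, m, u)` is dagger Frobenius if `m` and the comultiplication `m†` satisfy the
Frobenius equations `(A ⊗ m) ∘ (m† ⊗ A) = m† ∘ m = (m ⊗ A) ∘ (A ⊗ m†)`. -/
structure IsDaggerFrobenius (A : C) [MonObj A] : Prop where
  left : dag μ[A] ▷ A ≫ (α_ A A A).hom ≫ A ◁ μ[A] = μ[A] ≫ dag μ[A]
  right : A ◁ dag μ[A] ≫ (α_ A A A).inv ≫ μ[A] ▷ A = μ[A] ≫ dag μ[A]

/-- The conjugate `f_* = (f†)^* : A^* ⟶ B^*` of a morphism `f : A ⟶ B`. -/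
def conj {A B : C} [HasLeftDual A] [HasLeftDual B] (f : A ⟶ B) : (ᘁA : C) ⟶ (ᘁB : C) :=
  ᘁ(dag f)

/-- The (right) involution `(A^* ⊗ (u† ∘ m)) ∘ (ε_A ⊗ A) : A ⟶ A^*` of a dagger Frobenius
monoid, where `ε_A : I ⟶ A^* ⊗ A` is the duality morphism. -/
def involution (A : C) [MonObj A] [HasLeftDual A] : A ⟶ (ᘁA : C) :=
  (λ_ A).inv ≫ η_ (ᘁA : C) A ▷ A ≫ (α_ (ᘁA : C) A A).hom ≫
    (ᘁA : C) ◁ (μ[A] ≫ dag η[A]) ≫ (ρ_ (ᘁA : C)).hom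

/-- A morphism between dagger Frobenius monoids preserves the involution if
`s_B ∘ f = f_* ∘ s_A`. -/
def PreservesInvolution {A B : C} [MonObj A] [MonObj B] [HasLeftDual A] [HasLeftDual B]
    (f : A ⟶ B) : Prop :=
  f ≫ involution B = involution A ≫ conj f

variable (C) in
/-- A classical structure: a commutative dagger Frobenius monoid. -/
structure ClassicalStructure [BraidedCategory C] where
  /-- the underlying object -/
  X : C
  [mon : MonObj X]
  [comm : IsCommMonObj X]
  frobenius : IsDaggerFrobenius X

attribute [instance] ClassicalStructure.mon ClassicalStructure.comm

namespace ClassicalStructure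

variable [BraidedCategory C] [LeftRigidCategory C]

/-- Involution-preserving monoid homomorphisms. -/
@[ext]
structure Hom (A B : ClassicalStructure C) where
  /-- the underlying morphism -/
  hom : A.X ⟶ B.X
  isMonHom : IsMonHom hom
  preservesInvolution : PreservesInvolution hom

/-- The category of classical structures and involution-preserving monoid homomorphisms. -/
instance : Category (ClassicalStructure C) where
  Hom A B := Hom A B
  id A := ⟨𝟙 A.X, inferInstance, by simp [PreservesInvolution, conj, dag_id]⟩
  comp {A B D} f g := ⟨f.hom ≫ g.hom,
    have := f.isMonHom; have := g.isMonHom; inferInstance, by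
    have hf := f.preservesInvolution
    have hg := g.preservesInvolution
    simp only [PreservesInvolution, conj] at *
    rw [Category.assoc, hg, reassoc_of% hf, dag_comp, comp_leftAdjointMate]⟩
  id_comp f := Hom.ext (Category.id_comp f.hom)
  comp_id f := Hom.ext (Category.comp_id f.hom)
  assoc f g h := Hom.ext (Category.assoc f.hom g.hom h.hom)

end ClassicalStructure

end ClassicalStructures

/-! ### Finite-dimensional Hilbert spaces -/

/-- A finite-dimensional complex Hilbert space. -/
structure Hilb where
  /-- the underlying type -/
  carrier : Type
  [normedAddCommGroup : NormedAddCommGroup carrier]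
  [innerProductSpace : InnerProductSpace ℂ carrier]
  [finiteDimensional : FiniteDimensional ℂ carrier]

namespace Hilb

open scoped TensorProduct

instance : CoeSort Hilb Type := ⟨carrier⟩

attribute [instance] normedAddCommGroup innerProductSpace finiteDimensional

instance (V : Hilb) : CompleteSpace V := FiniteDimensional.complete ℂ V

instance (V W : Hilb) : CompleteSpace (V ⊗[ℂ] W) := FiniteDimensional.complete ℂ _

/-- Morphisms of Hilbert spaces: continuous linear maps. -/
@[ext]
structure Hom (V W : Hilb) where
  /-- the underlying continuous linear map -/
  hom : V →L[ℂ] W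

instance : Category Hilb where
  Hom V W := Hom V W
  id V := ⟨ContinuousLinearMap.id ℂ V⟩
  comp f g := ⟨g.hom.comp f.hom⟩

@[ext]
lemma hom_ext {V W : Hilb} {f g : V ⟶ W} (h : f.hom = g.hom) : f = g := Hom.ext h

@[simp] lemma id_hom (V : Hilb) : Hom.hom (𝟙 V) = ContinuousLinearMap.id ℂ V := rfl

@[simp] lemma comp_hom {U V W : Hilb} (f : U ⟶ V) (g : V ⟶ W) :
    (f ≫ g).hom = g.hom.comp f.hom := rfl

/-- The dagger of a continuous linear map is its Hilbert space adjoint. -/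
noncomputable instance : DaggerCategory Hilb where
  dag f := ⟨ContinuousLinearMap.adjoint f.hom⟩
  dag_id V := by
    ext1
    exact ContinuousLinearMap.adjoint_id
  dag_comp f g := by
    ext1
    exact ContinuousLinearMap.adjoint_comp g.hom f.hom
  dag_dag f := by
    ext1
    exact ContinuousLinearMap.adjoint_adjoint f.hom

@[simp] lemma dag_hom {V W : Hilb} (f : V ⟶ W) :
    (dag f).hom = ContinuousLinearMap.adjoint f.hom := rfl

/-- An isometric isomorphism, as an isomorphism of `Hilb`. -/
@[simps]
def isoOfIsometry {V W : Hilb} (e : V ≃ₗᵢ[ℂ] W) : V ≅ W where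
  hom := ⟨e.toContinuousLinearEquiv⟩
  inv := ⟨e.symm.toContinuousLinearEquiv⟩
  hom_inv_id := by ext x; exact e.symm_apply_apply x
  inv_hom_id := by ext x; exact e.apply_symm_apply x

/-- The Hilbert space tensor product. -/
noncomputable instance : MonoidalCategoryStruct Hilb where
  tensorObj V W := ⟨V ⊗[ℂ] W⟩
  tensorUnit := ⟨ℂ⟩
  whiskerLeft V _ _ f := ⟨f.hom.lTensor V⟩
  whiskerRight f W := ⟨f.hom.rTensor W⟩
  tensorHom f g := ⟨TensorProduct.mapL f.hom g.hom⟩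
  associator U V W := isoOfIsometry (TensorProduct.assocIsometry ℂ U V W)
  leftUnitor V := isoOfIsometry (TensorProduct.lidIsometry ℂ V)
  rightUnitor V := isoOfIsometry (TensorProduct.ridIsometry ℂ V)

lemma hom_ext_linear {V W : Hilb} {f g : V ⟶ W}
    (h : (f.hom : V →ₗ[ℂ] W) = (g.hom : V →ₗ[ℂ] W)) : f = g := by
  ext1
  exact ContinuousLinearMap.coe_injective h

noncomputable instance : MonoidalCategory Hilb := MonoidalCategory.ofTensorHom
  (id_tensorHom_id := fun V W => by
    apply hom_ext_linear
    apply TensorProduct.ext'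
    intros; rfl)
  (id_tensorHom := fun V _ _ f => by
    apply hom_ext_linear
    apply TensorProduct.ext'
    intros; rfl)
  (tensorHom_id := fun f V => by
    apply hom_ext_linear
    apply TensorProduct.ext'
    intros; rfl)
  (tensorHom_comp_tensorHom := fun f g h k => by
    apply hom_ext_linear
    apply TensorProduct.ext'
    intros; rfl)
  (associator_naturality := fun f g h => by
    apply hom_ext_linear
    apply TensorProduct.ext_threefold
    intros; rfl)
  (leftUnitor_naturality := fun f => by
    apply hom_ext_linear
    apply TensorProduct.ext'
    intro (c : ℂ) x
    exact (map_smul f.hom c x).symm)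
  (rightUnitor_naturality := fun f => by
    apply hom_ext_linear
    apply TensorProduct.ext'
    intro x (c : ℂ)
    exact (map_smul f.hom c x).symm)
  (pentagon := fun U V W X => by
    apply hom_ext_linear
    apply TensorProduct.ext_fourfold
    intros; rfl)
  (triangle := fun V W => by
    apply hom_ext_linear
    apply TensorProduct.ext_threefold
    intro x (c : ℂ) y
    exact (TensorProduct.smul_tmul c x y).symm)

noncomputable instance : SymmetricCategory Hilb where
  braiding V W := isoOfIsometry (TensorProduct.commIsometry ℂ V W)
  braiding_naturality_right V _ _ f := by
    apply hom_ext_linear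
    apply TensorProduct.ext'
    intros; rfl
  braiding_naturality_left f W := by
    apply hom_ext_linear
    apply TensorProduct.ext'
    intros; rfl
  hexagon_forward U V W := by
    apply hom_ext_linear
    apply TensorProduct.ext_threefold
    intros; rfl
  hexagon_reverse U V W := by
    apply hom_ext_linear
    apply TensorProduct.ext_threefold'
    intros; rfl
  symmetry V W := by
    apply hom_ext_linear
    apply TensorProduct.ext'
    intros; rfl

lemma isUnitary_isoOfIsometry {V W : Hilb} (e : V ≃ₗᵢ[ℂ] W) :
    IsUnitary (isoOfIsometry e).hom := by
  have h : dag (isoOfIsometry e).hom = (isoOfIsometry e).inv := by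
    ext1
    exact e.adjoint_eq_symm
  exact ⟨by rw [h, Iso.hom_inv_id], by rw [h, Iso.inv_hom_id]⟩

instance : SymmetricMonoidalDaggerCategory Hilb where
  dag_tensor f g := by
    ext1
    exact TensorProduct.adjoint_mapL f.hom g.hom
  unitary_associator U V W := isUnitary_isoOfIsometry _
  unitary_leftUnitor V := isUnitary_isoOfIsometry _
  unitary_rightUnitor V := isUnitary_isoOfIsometry _
  unitary_braiding V W := isUnitary_isoOfIsometry _

section Dual

variable (E F : Type) [NormedAddCommGroup E] [InnerProductSpace ℂ E] [FiniteDimensional ℂ E]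
  [NormedAddCommGroup F] [InnerProductSpace ℂ F]

/-- The inner product on the dual of a Hilbert space for which the antilinear Riesz isomorphism is
isometric. -/
noncomputable abbrev dualInnerProductSpace [CompleteSpace E] :
    InnerProductSpace ℂ (StrongDual ℂ E) where
  inner φ ψ :=
    inner ℂ ((InnerProductSpace.toDual ℂ E).symm ψ) ((InnerProductSpace.toDual ℂ E).symm φ)
  norm_sq_eq_re_inner φ := by
    rw [← norm_sq_eq_re_inner, LinearIsometryEquiv.norm_map]
  conj_inner_symm φ ψ := inner_conj_symm _ _
  add_left φ ψ χ := by rw [map_add, inner_add_right]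
  smul_left φ ψ c := by rw [map_smulₛₗ, inner_smul_right]

/-- The evaluation pairing `v ⊗ φ ↦ φ v`. -/
noncomputable def evalPairing : E ⊗[ℂ] StrongDual ℂ E →ₗ[ℂ] ℂ :=
  TensorProduct.lift (ContinuousLinearMap.coeLM ℂ : (E →L[ℂ] ℂ) →ₗ[ℂ] _).flip

/-- The element `∑ i, ⟨e i, -⟩ ⊗ e i` for an orthonormal basis `e`. -/
noncomputable def coevalElement : StrongDual ℂ E ⊗[ℂ] E :=
  ∑ i, innerSL ℂ (stdOrthonormalBasis ℂ E i) ⊗ₜ[ℂ] stdOrthonormalBasis ℂ E i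

lemma dual_expansion (φ : StrongDual ℂ E) :
    ∑ i, φ (stdOrthonormalBasis ℂ E i) • innerSL ℂ (stdOrthonormalBasis ℂ E i) = φ := by
  ext x
  conv_rhs => rw [← (stdOrthonormalBasis ℂ E).sum_repr' x, map_sum]
  simp [mul_comm]

lemma eval_coeval_left (x : E) (c : ℂ) :
    (evalPairing E).rTensor E ((TensorProduct.assoc ℂ E (StrongDual ℂ E) E).symm
      (x ⊗ₜ[ℂ] (c • coevalElement E))) = (1 : ℂ) ⊗ₜ[ℂ] (c • x) := by
  conv_rhs => rw [← (stdOrthonormalBasis ℂ E).sum_repr' x]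
  simp [coevalElement, evalPairing, TensorProduct.tmul_sum, TensorProduct.tmul_smul,
    TensorProduct.smul_tmul']

lemma eval_coeval_right (φ : StrongDual ℂ E) (c : ℂ) :
    (evalPairing E).lTensor (StrongDual ℂ E)
      ((TensorProduct.assoc ℂ (StrongDual ℂ E) E (StrongDual ℂ E))
        ((c • coevalElement E) ⊗ₜ[ℂ] φ)) = (c • φ) ⊗ₜ[ℂ] (1 : ℂ) := by
  conv_rhs => rw [← dual_expansion E φ]
  simp [coevalElement, evalPairing, TensorProduct.sum_tmul, ← TensorProduct.smul_tmul',
    TensorProduct.smul_tmul c, Finset.smul_sum, ← TensorProduct.tmul_smul, mul_comm]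

lemma mate_apply (f : E →ₗ[ℂ] F) (φ : StrongDual ℂ F) :
    TensorProduct.rid ℂ (StrongDual ℂ E) ((evalPairing F).lTensor (StrongDual ℂ E)
      ((TensorProduct.assoc ℂ (StrongDual ℂ E) F (StrongDual ℂ F))
        ((f.lTensor (StrongDual ℂ E)).rTensor (StrongDual ℂ F)
          (((1 : ℂ) • coevalElement E) ⊗ₜ[ℂ] φ)))) =
      φ.comp (LinearMap.toContinuousLinearMap f) := by
  conv_rhs => rw [← dual_expansion E (φ.comp (LinearMap.toContinuousLinearMap f))]
  simp [coevalElement, evalPairing, TensorProduct.sum_tmul]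

end Dual

/-- The dual Hilbert space. -/
noncomputable def dual (V : Hilb) : Hilb :=
  letI := dualInnerProductSpace V
  ⟨StrongDual ℂ V⟩

/-- The evaluation `V ⊗ V^* ⟶ ℂ`. -/
noncomputable def dualEval (V : Hilb) : V ⊗ dual V ⟶ 𝟙_ Hilb :=
  ⟨LinearMap.toContinuousLinearMap (F' := ℂ) (E := (V ⊗ dual V : Hilb)) (evalPairing V)⟩

/-- The coevaluation `ℂ ⟶ V^* ⊗ V`. -/
noncomputable def dualCoeval (V : Hilb) : 𝟙_ Hilb ⟶ dual V ⊗ V :=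
  ⟨ContinuousLinearMap.toSpanSingleton ℂ (M₁ := (dual V ⊗ V : Hilb)) (coevalElement V)⟩

noncomputable instance (V : Hilb) : ExactPairing (dual V) V where
  coevaluation' := dualCoeval V
  evaluation' := dualEval V
  coevaluation_evaluation' := by
    apply hom_ext_linear
    apply TensorProduct.ext'
    intro x c
    exact eval_coeval_left V x c
  evaluation_coevaluation' := by
    apply hom_ext_linear
    apply TensorProduct.ext'
    intro c φ
    exact (ContinuousLinearMap.lTensor_apply (E := dual V) (dualEval V).hom _).trans
      (eval_coeval_right V φ c)

noncomputable instance : LeftRigidCategory Hilb where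
  leftDual V := { leftDual := dual V }

lemma leftAdjointMate_apply {V W : Hilb} (f : V ⟶ W) (φ : StrongDual ℂ W) :
    (ᘁf).hom φ = (φ.comp f.hom : StrongDual ℂ V) :=
  (congrArg (TensorProduct.rid ℂ (dual V))
    ((ContinuousLinearMap.lTensor_apply (E := dual V) (dualEval W).hom _).trans
      (congrArg (fun z => (dualEval W).hom.toLinearMap.lTensor (dual V)
          ((TensorProduct.assoc ℂ (dual V) W (dual W)) (z ⊗ₜ[ℂ] φ)))
        (ContinuousLinearMap.lTensor_apply (E := dual V) f.hom
          ((1 : ℂ) • coevalElement V))))).trans (mate_apply V W f.hom φ)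

lemma leftAdjointMate_toDual {V W : Hilb} (f : V ⟶ W) (w : W) :
    (ᘁf).hom (InnerProductSpace.toDual ℂ W w : StrongDual ℂ W) =
      (InnerProductSpace.toDual ℂ V (ContinuousLinearMap.adjoint f.hom w) : StrongDual ℂ V) := by
  rw [leftAdjointMate_apply]
  refine ContinuousLinearMap.ext fun x => ?_
  exact (ContinuousLinearMap.adjoint_inner_left f.hom x w).symm

lemma dag_leftAdjointMate {V W : Hilb} (f : V ⟶ W) : dag (ᘁf) = ᘁ(dag f) := by
  ext1
  refine (ContinuousLinearMap.eq_adjoint_iff _ _).2 ?_ |>.symm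
  intro φ ψ
  obtain ⟨x, rfl⟩ := (InnerProductSpace.toDual ℂ V).surjective φ
  obtain ⟨y, rfl⟩ := (InnerProductSpace.toDual ℂ W).surjective ψ
  rw [leftAdjointMate_toDual, leftAdjointMate_toDual]
  change inner ℂ ((InnerProductSpace.toDual ℂ W).symm _) ((InnerProductSpace.toDual ℂ W).symm _) =
    inner ℂ ((InnerProductSpace.toDual ℂ V).symm _) ((InnerProductSpace.toDual ℂ V).symm _)
  rw [LinearIsometryEquiv.symm_apply_apply, LinearIsometryEquiv.symm_apply_apply,
    LinearIsometryEquiv.symm_apply_apply, LinearIsometryEquiv.symm_apply_apply]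
  simp [ContinuousLinearMap.adjoint_inner_left]

end Hilb

/-! ### Unitary representations of a groupoid -/

section HilbRep

variable (G : Type u) [Groupoid.{v} G]

/-- A functor `G ⥤ Hilb` is a unitary representation if it commutes with the daggers, the dagger
of a groupoid being inversion. -/
def isUnitaryRep : ObjectProperty (G ⥤ Hilb) :=
  fun A => ∀ ⦃x y : G⦄ (g : x ⟶ y), A.map (Groupoid.inv g) = dag (A.map g)

instance : (isUnitaryRep G).IsMonoidal where
  prop_unit x y g := (dag_id _).symm
  prop_tensor A B hA hB x y g := by
    change A.map _ ⊗ₘ B.map _ = dag (A.map g ⊗ₘ B.map g)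
    rw [hA, hB, SymmetricMonoidalDaggerCategory.dag_tensor]

/-- The category `Hilb^G` of finite-dimensional unitary representations of the groupoid `G` and
intertwiners, with the pointwise tensor product. -/
abbrev HilbRep := (isUnitaryRep G).FullSubcategory

variable {G}

/-- The pointwise adjoint of an intertwiner. -/
noncomputable instance : DaggerCategory (HilbRep G) where
  dag {A B} f := ObjectProperty.homMk
    { app := fun x => dag (f.hom.app x)
      naturality := fun x y g => by
        have h := congrArg dag (f.hom.naturality (Groupoid.inv g))
        rw [dag_comp, dag_comp, A.property, B.property, dag_dag, dag_dag] at h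
        exact h.symm }
  dag_id A := by
    ext x : 3
    exact dag_id _
  dag_comp f g := by
    ext x : 3
    exact dag_comp _ _
  dag_dag f := by
    ext x : 3
    exact dag_dag _

lemma HilbRep.isUnitary_iff {A B : HilbRep G} (f : A ⟶ B) :
    IsUnitary f ↔ ∀ x, IsUnitary (f.hom.app x) := by
  constructor
  · intro h x
    exact ⟨congrArg (fun k => k.hom.app x) h.1, congrArg (fun k => k.hom.app x) h.2⟩
  · intro h
    constructor
    · ext x : 3
      exact (h x).1
    · ext x : 3
      exact (h x).2

instance : SymmetricMonoidalDaggerCategory (HilbRep G) where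
  dag_tensor f g := by
    ext x : 3
    exact SymmetricMonoidalDaggerCategory.dag_tensor _ _
  unitary_associator A B D := (HilbRep.isUnitary_iff _).2
    fun x => SymmetricMonoidalDaggerCategory.unitary_associator _ _ _
  unitary_leftUnitor A := (HilbRep.isUnitary_iff _).2
    fun x => SymmetricMonoidalDaggerCategory.unitary_leftUnitor _
  unitary_rightUnitor A := (HilbRep.isUnitary_iff _).2
    fun x => SymmetricMonoidalDaggerCategory.unitary_rightUnitor _
  unitary_braiding A B := (HilbRep.isUnitary_iff _).2
    fun x => SymmetricMonoidalDaggerCategory.unitary_braiding _ _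

/-- The dual of a unitary representation, with `g` acting on `(A x)^*` as the transpose of the
action of `g⁻¹`. -/
noncomputable def HilbRep.dual (A : HilbRep G) : HilbRep G where
  obj := ᘁ(A.obj)
  property x y g := by
    change (ᘁ(A.obj.map (inv (Groupoid.inv g)))) = dag (ᘁ(A.obj.map (inv g)))
    rw [Hilb.dag_leftAdjointMate, ← Groupoid.inv_eq_inv, ← Groupoid.inv_eq_inv, A.property]

noncomputable instance (A : HilbRep G) : ExactPairing (HilbRep.dual A) A where
  coevaluation' := ObjectProperty.homMk (η_ (ᘁ(A.obj)) A.obj)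
  evaluation' := ObjectProperty.homMk (ε_ (ᘁ(A.obj)) A.obj)
  coevaluation_evaluation' := by
    ext1
    exact ExactPairing.coevaluation_evaluation (ᘁ(A.obj)) A.obj
  evaluation_coevaluation' := by
    ext1
    exact ExactPairing.evaluation_coevaluation (ᘁ(A.obj)) A.obj

noncomputable instance : LeftRigidCategory (HilbRep G) where
  leftDual A := { leftDual := HilbRep.dual A }

end HilbRep

/-! ### Finite Boolean toposes and their quantum analogues -/

/-- A finite quantum Boolean topos: a symmetric monoidal dagger category with a strong symmetric
monoidal dagger equivalence to `Hilb^G` for some finite groupoid `G`. -/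
def IsFiniteQuantumBooleanTopos (Q : Type u) [Category.{v} Q] [MonoidalCategory Q]
    [SymmetricCategory Q] [DaggerCategory Q] [SymmetricMonoidalDaggerCategory Q] : Prop :=
  ∃ (G : Type) (_ : Groupoid.{0} G) (_ : Finite G) (_ : ∀ x y : G, Finite (x ⟶ y))
    (F : Q ⥤ HilbRep G) (_ : F.Braided), IsDaggerEquivalence F

/-- A finite Boolean topos: a category equivalent to `FinSet^G` for some finite groupoid `G`. -/
def IsFiniteBooleanTopos (T : Type u) [Category.{v} T] : Prop :=
  ∃ (G : Type) (_ : Groupoid.{0} G) (_ : Finite G) (_ : ∀ x y : G, Finite (x ⟶ y)),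
    Nonempty (T ≌ (G ⥤ FintypeCat.{0}))

end QuantumTopos

/-! The theorem is finite-dimensional Gelfand duality, done equivariantly. A classical structure in
`Hilb^G` is a family of finite-dimensional commutative algebras on Hilbert spaces, permuted by `G`.
The Frobenius law makes the adjoint of multiplication by `a` again multiplication by some element
`a'` (`exists_adjoint_mul`). As in a C*-algebra, this rules out nilpotents (`isReduced_of_form`), so
each fiber is a product of copies of `ℂ` and is recovered from its finite set of characters
(`eq_of_characters_eq`, `exists_forall_character_apply_eq`). Taking characters fiberwise gives a
contravariant functor to finite `G`-sets, and `ℓ²` of a `G`-set with pointwise multiplication shows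
that every `G`-set is attained.

The involution condition on morphisms turns out to be automatic in `Hilb^G`
(`preservesInvolution_of_isMonHom`). Characters satisfy `χ(a') = conj (χ a)`, so every algebra
homomorphism carries adjoint multipliers to adjoint multipliers. Fullness therefore needs only
algebra homomorphisms.

To pass from `Hilb^G` to an arbitrary `Q`, classical structures are moved along a dagger
equivalence. The chosen duals never have to be compared, because bending the dual leg turns the
involution condition into an identity between maps `B ⊗ A ⟶ I` (`preservesInvolution_iff`).
Unitarity of the structure maps and of the isomorphisms in essential surjectivity makes the adjoint
of a multiplication go to the adjoint of the transported multiplication. -/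

namespace QuantumTopos

open DaggerCategory Functor
open scoped MonObj

/-! ### Involutions without reference to duals -/

section Involution

variable {C : Type u} [Category.{v} C] [MonoidalCategory C]

/-- Morphisms into a left dual are determined by their pairing with the object. -/
lemma hom_leftDual_ext {A X : C} [HasLeftDual A] {h k : X ⟶ (ᘁA : C)}
    (e : A ◁ h ≫ ε_ (ᘁA : C) A = A ◁ k ≫ ε_ (ᘁA : C) A) : h = k := by
  have := congrArg (tensorLeftHomEquiv _ (ᘁA : C) A _) e
  rw [tensorLeftHomEquiv_whiskerLeft_comp_evaluation,
    tensorLeftHomEquiv_whiskerLeft_comp_evaluation] at this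
  simpa using this

variable [DaggerCategory C]

/-- The involution is the pairing `u† ∘ m` curried through the duality; this uncurries it. -/
lemma whiskerLeft_involution_comp_evaluation (A : C) [MonObj A] [HasLeftDual A] :
    A ◁ involution A ≫ ε_ (ᘁA : C) A = μ[A] ≫ dag η[A] := by
  apply (tensorLeftHomEquiv _ (ᘁA : C) A _).injective
  rw [tensorLeftHomEquiv_whiskerLeft_comp_evaluation]
  simp [involution, tensorLeftHomEquiv]

/-- A formulation of preservation of the involution that does not mention duals. -/
lemma preservesInvolution_iff {A B : C} [MonObj A] [MonObj B] [HasLeftDual A] [HasLeftDual B]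
    (f : A ⟶ B) :
    PreservesInvolution f ↔ B ◁ f ≫ μ[B] ≫ dag η[B] = dag f ▷ A ≫ μ[A] ≫ dag η[A] := by
  have h₁ : B ◁ (f ≫ involution B) ≫ ε_ (ᘁB : C) B = B ◁ f ≫ μ[B] ≫ dag η[B] := by
    rw [MonoidalCategory.whiskerLeft_comp, Category.assoc, whiskerLeft_involution_comp_evaluation]
  -- The conjugate of `f` is the transpose of `f†`, so it slides across the evaluation and becomes
  -- `f†` on the left leg.
  have h₂ : B ◁ (involution A ≫ conj f) ≫ ε_ (ᘁB : C) B = dag f ▷ A ≫ μ[A] ≫ dag η[A] := by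
    rw [conj, MonoidalCategory.whiskerLeft_comp, Category.assoc, leftAdjointMate_comp_evaluation,
      whisker_exchange_assoc, whiskerLeft_involution_comp_evaluation]
  rw [← h₁, ← h₂]
  exact ⟨fun h => by rw [show f ≫ involution B = _ from h], hom_leftDual_ext⟩

end Involution

/-! ### Transport along unitary isomorphisms -/

section Unitary

variable {C : Type u} [Category.{v} C] [DaggerCategory C]

/-- A unitary morphism, as an isomorphism. -/
@[simps]
def IsUnitary.iso {X Y : C} {f : X ⟶ Y} (h : IsUnitary f) : X ≅ Y where
  hom := f
  inv := dag f
  hom_inv_id := h.1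
  inv_hom_id := h.2

lemma IsUnitary.dag_eq {X Y : C} {f : X ⟶ Y} (h : IsUnitary f) {g : Y ⟶ X} (hg : f ≫ g = 𝟙 X) :
    dag f = g := by
  rw [← Category.comp_id (dag f), ← Category.id_comp g, ← h.2, Category.assoc, hg]

variable [MonoidalCategory C]

/-- Unitary homomorphisms of monoids preserve the involution. -/
lemma IsUnitary.preservesInvolution {A B : C} [MonObj A] [MonObj B] [HasLeftDual A] [HasLeftDual B]
    {f : A ⟶ B} (hf : IsUnitary f) [IsMonHom f] : PreservesInvolution f := by
  rw [preservesInvolution_iff, ← IsMonHom.one_hom f, dag_comp]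
  -- Multiplicativity of `f`, with one `f` moved to the other side as its inverse `f†`.
  have : dag f ▷ A ≫ μ[A] = B ◁ f ≫ μ[B] ≫ dag f := by
    rw [← Category.comp_id μ[A], ← hf.1, IsMonHom.mul_hom_assoc, ← tensorHom_id, ← id_tensorHom,
      tensorHom_comp_tensorHom_assoc, hf.2, Category.id_comp]
  rw [reassoc_of% this]

variable [SymmetricCategory C] [SymmetricMonoidalDaggerCategory C]

/-- The dagger Frobenius equations are transported along unitary isomorphisms of monoids. -/
lemma IsDaggerFrobenius.of_unitary {A B : C} [MonObj A] [MonObj B] (hA : IsDaggerFrobenius A)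
    {f : A ⟶ B} (hf : IsUnitary f) [IsMonHom f] : IsDaggerFrobenius B := by
  have h₁ : μ[A] ≫ f = (f ⊗ₘ f) ≫ μ[B] := IsMonHom.mul_hom f
  -- Daggering multiplicativity says that `f†` is comultiplicative; inverting with unitarity, so is
  -- `f`. The Frobenius equations then follow by conjugation with `f ⊗ f`.
  have h₂ : f ≫ dag μ[B] = dag μ[A] ≫ (f ⊗ₘ f) := by
    have h := congrArg dag h₁
    rw [dag_comp, dag_comp, SymmetricMonoidalDaggerCategory.dag_tensor] at h
    rw [← Category.comp_id (f ≫ dag μ[B]), ← id_tensorHom_id, ← hf.2,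
      ← tensorHom_comp_tensorHom, Category.assoc, ← reassoc_of% h, reassoc_of% hf.1]
  have : IsIso f := hf.iso.isIso_hom
  have h₃ : (f ⊗ₘ f) ≫ μ[B] ≫ dag μ[B] = (μ[A] ≫ dag μ[A]) ≫ (f ⊗ₘ f) := by
    rw [← reassoc_of% h₁, h₂, Category.assoc]
  constructor
  · rw [← cancel_epi (f ⊗ₘ f), h₃, ← hA.left]
    simp only [← tensorHom_id, ← id_tensorHom, Category.assoc, tensorHom_comp_tensorHom,
      tensorHom_comp_tensorHom_assoc, Category.comp_id, Category.id_comp, h₁, h₂]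
    have h₄ : (f ⊗ₘ (f ⊗ₘ f) ≫ μ[B]) = (f ⊗ₘ (f ⊗ₘ f)) ≫ (𝟙 B ⊗ₘ μ[B]) := by
      rw [tensorHom_comp_tensorHom, Category.comp_id]
    rw [h₄, ← associator_naturality_assoc, tensorHom_comp_tensorHom_assoc, Category.id_comp]
  · rw [← cancel_epi (f ⊗ₘ f), h₃, ← hA.right]
    simp only [← tensorHom_id, ← id_tensorHom, Category.assoc, tensorHom_comp_tensorHom,
      tensorHom_comp_tensorHom_assoc, Category.comp_id, Category.id_comp, h₁, h₂]
    have h₄ : ((f ⊗ₘ f) ≫ μ[B] ⊗ₘ f) = ((f ⊗ₘ f) ⊗ₘ f) ≫ (μ[B] ⊗ₘ 𝟙 B) := by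
      rw [tensorHom_comp_tensorHom, Category.comp_id]
    rw [h₄, ← associator_inv_naturality_assoc, tensorHom_comp_tensorHom_assoc, Category.id_comp]

end Unitary

/-! ### Transport along dagger equivalences -/

section Transport

variable {C : Type u} {D : Type u'} [Category.{v} C] [Category.{v'} D]
    [MonoidalCategory C] [SymmetricCategory C] [DaggerCategory C]
    [MonoidalCategory D] [SymmetricCategory D] [DaggerCategory D]
    {F : C ⥤ D} [F.Braided]

open scoped Obj

lemma IsDaggerEquivalence.dag_μ (hF : IsDaggerEquivalence F) (X Y : C) :
    dag (LaxMonoidal.μ F X Y) = OplaxMonoidal.δ F X Y :=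
  (hF.unitary_μ X Y).dag_eq (by simp)

lemma IsDaggerEquivalence.dag_ε (hF : IsDaggerEquivalence F) :
    dag (LaxMonoidal.ε F) = OplaxMonoidal.η F :=
  hF.unitary_ε.dag_eq (by simp)

/-- The dagger Frobenius equations are preserved and reflected by dagger equivalences. -/
lemma IsDaggerEquivalence.isDaggerFrobenius_obj_iff (hF : IsDaggerEquivalence F) (A : C)
    [MonObj A] :
    IsDaggerFrobenius (F.obj A) ↔ IsDaggerFrobenius A := by
  have hd : dag μ[F.obj A] = F.map (dag μ[A]) ≫ OplaxMonoidal.δ F A A := by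
    rw [Functor.obj.μ_def, dag_comp, hF.dag_μ, hF.map_dag]
  have h : μ[F.obj A] ≫ dag μ[F.obj A] =
      LaxMonoidal.μ F A A ≫ F.map (μ[A] ≫ dag μ[A]) ≫ OplaxMonoidal.δ F A A := by
    rw [hd, Functor.obj.μ_def]; simp
  have hl : dag μ[F.obj A] ▷ F.obj A ≫ (α_ _ _ _).hom ≫ F.obj A ◁ μ[F.obj A] =
      LaxMonoidal.μ F A A ≫ F.map (dag μ[A] ▷ A ≫ (α_ A A A).hom ≫ A ◁ μ[A]) ≫
        OplaxMonoidal.δ F A A := by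
    rw [hd, Functor.obj.μ_def]
    simp only [Functor.map_comp, Functor.Monoidal.map_whiskerLeft,
      Functor.Monoidal.map_whiskerRight, Functor.Monoidal.map_associator,
      Category.assoc, comp_whiskerRight,
      MonoidalCategory.whiskerLeft_comp, Functor.Monoidal.μ_δ_assoc, Functor.Monoidal.μ_δ,
      Category.comp_id]
  have hr : F.obj A ◁ dag μ[F.obj A] ≫ (α_ _ _ _).inv ≫ μ[F.obj A] ▷ F.obj A =
      LaxMonoidal.μ F A A ≫ F.map (A ◁ dag μ[A] ≫ (α_ A A A).inv ≫ μ[A] ▷ A) ≫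
        OplaxMonoidal.δ F A A := by
    rw [hd, Functor.obj.μ_def]
    simp only [Functor.map_comp, Functor.Monoidal.map_whiskerLeft,
      Functor.Monoidal.map_whiskerRight,
      Functor.Monoidal.map_associator_inv, Category.assoc, comp_whiskerRight,
      MonoidalCategory.whiskerLeft_comp, Functor.Monoidal.μ_δ_assoc, Functor.Monoidal.μ_δ,
      Category.comp_id]
  -- Each side of the Frobenius equations for `F A` is the image of the one for `A`, conjugated by
  -- the tensorator; faithfulness lets both be stripped off.
  have hc {f g : A ⊗ A ⟶ A ⊗ A} :
      LaxMonoidal.μ F A A ≫ F.map f ≫ OplaxMonoidal.δ F A A =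
        LaxMonoidal.μ F A A ≫ F.map g ≫ OplaxMonoidal.δ F A A ↔ f = g := by
    have := hF.faithful
    rw [cancel_epi, cancel_mono, F.map_injective.eq_iff]
  constructor
  · intro H
    exact ⟨hc.1 (by rw [← hl, ← h, H.left]), hc.1 (by rw [← hr, ← h, H.right])⟩
  · intro H
    exact ⟨by rw [hl, h, H.left], by rw [hr, h, H.right]⟩

/-- Only the underlying monoidal equivalence matters: left duals pull back along it. -/
lemma IsDaggerEquivalence.nonempty_leftRigidCategory [LeftRigidCategory D]
    (hF : IsDaggerEquivalence F) :
    Nonempty (LeftRigidCategory C) := by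
  have := hF.full
  have := hF.faithful
  have : F.EssSurj := ⟨fun Y => by
    obtain ⟨X, f, hf⟩ := hF.unitarily_essSurj Y
    exact ⟨X, ⟨hf.iso⟩⟩⟩
  have : F.IsEquivalence := { }
  exact ⟨leftRigidCategoryOfEquivalence (F := F) (G := F.inv) F.asEquivalence.toAdjunction⟩

variable [LeftRigidCategory C] [LeftRigidCategory D]

/-- Preservation of the involution is preserved and reflected by dagger equivalences. -/
lemma IsDaggerEquivalence.preservesInvolution_map_iff (hF : IsDaggerEquivalence F) {A B : C}
    [MonObj A] [MonObj B] (f : A ⟶ B) :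
    PreservesInvolution (F.map f) ↔ PreservesInvolution f := by
  -- In the dual-free criterion only the pairing `u† ∘ m` appears, and `F` preserves it up to
  -- structure isomorphisms.
  have h (B : C) [MonObj B] : μ[F.obj B] ≫ dag η[F.obj B] =
      LaxMonoidal.μ F B B ≫ F.map (μ[B] ≫ dag η[B]) ≫ OplaxMonoidal.η F := by
    rw [Functor.obj.μ_def, Functor.obj.η_def, dag_comp, hF.dag_ε, ← hF.map_dag]; simp
  have := hF.faithful
  rw [preservesInvolution_iff, preservesInvolution_iff, h, h, ← hF.map_dag,
    LaxMonoidal.μ_natural_right_assoc, LaxMonoidal.μ_natural_left_assoc, cancel_epi,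
    ← F.map_comp_assoc, ← F.map_comp_assoc, cancel_mono,
    F.map_injective.eq_iff]

/-- The functor between categories of classical structures induced by a dagger equivalence. -/
def mapClassicalStructure (hF : IsDaggerEquivalence F) :
    ClassicalStructure C ⥤ ClassicalStructure D where
  obj A := ⟨F.obj A.X, (hF.isDaggerFrobenius_obj_iff A.X).2 A.frobenius⟩
  map f := ⟨F.map f.hom, have := f.isMonHom; inferInstance,
    (hF.preservesInvolution_map_iff _).2 f.preservesInvolution⟩
  map_id A := ClassicalStructure.Hom.ext (F.map_id A.X)
  map_comp f g := ClassicalStructure.Hom.ext (F.map_comp f.hom g.hom)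

lemma full_mapClassicalStructure (hF : IsDaggerEquivalence F) :
    (mapClassicalStructure hF).Full where
  map_surjective {A B} g := by
    have := hF.full
    have := hF.faithful
    obtain ⟨k, g_mon, g_inv⟩ := g
    change F.obj A.X ⟶ F.obj B.X at k
    obtain ⟨f, rfl⟩ := F.map_surjective k
    have f_mon : IsMonHom f := by
      have : IsMonHom (F.map f) := g_mon
      simpa using (FullyFaithful.ofFullyFaithful F).isMonHom_preimage (F.map f)
    exact ⟨⟨f, f_mon, (hF.preservesInvolution_map_iff f).1 g_inv⟩, rfl⟩

lemma faithful_mapClassicalStructure (hF : IsDaggerEquivalence F) :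
    (mapClassicalStructure hF).Faithful where
  map_injective {A B f g} h := by
    have := hF.faithful
    exact ClassicalStructure.Hom.ext
      (F.map_injective (congrArg ClassicalStructure.Hom.hom h))

/-- An isomorphism of underlying objects that is a monoid homomorphism and, together with its
inverse, preserves the involutions. -/
def ClassicalStructure.mkIso {A B : ClassicalStructure C} (e : A.X ≅ B.X) (h : IsMonHom e.hom)
    (h₁ : PreservesInvolution e.hom) (h₂ : PreservesInvolution e.inv) : A ≅ B where
  hom := ⟨e.hom, h, h₁⟩
  inv := ⟨e.inv, inferInstance, h₂⟩
  hom_inv_id := ClassicalStructure.Hom.ext e.hom_inv_id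
  inv_hom_id := ClassicalStructure.Hom.ext e.inv_hom_id

variable [SymmetricMonoidalDaggerCategory D]

/-- The isomorphism `F X ≅ B` must be unitary: an arbitrary one would carry the monoid across but
need not preserve the Frobenius equations, which involve `m†`. -/
lemma essSurj_mapClassicalStructure (hF : IsDaggerEquivalence F) :
    (mapClassicalStructure hF).EssSurj where
  mem_essImage B := by
    have := hF.full
    have := hF.faithful
    obtain ⟨X, f, hf⟩ := hF.unitarily_essSurj B.X
    have hf' : IsUnitary (dag f) := ⟨by rw [dag_dag, hf.2], by rw [dag_dag, hf.1]⟩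
    -- The multiplication of `B` is carried to `F X` along `f†`, then lifted to `X` by full
    -- faithfulness.
    let m : MonObj X := by
      letI : MonObj (F.obj X) := .ofIso hf.iso.symm
      exact (FullyFaithful.ofFullyFaithful F).monObj X
    have hm : IsMonHom (dag f) :=
      { one_hom := by
          simp [m, Functor.obj.η_def, MonObj.ofIso_one]
        mul_hom := by
          simp [m, Functor.obj.μ_def, MonObj.ofIso_mul, tensorHom_comp_tensorHom_assoc, hf.2] }
    have hm' : IsMonHom f := by
      have : IsMonHom hf.iso.symm.hom := hm
      exact inferInstanceAs (IsMonHom hf.iso.symm.inv)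
    have hX : IsDaggerFrobenius X :=
      (hF.isDaggerFrobenius_obj_iff X).1 (B.frobenius.of_unitary hf')
    have : IsIso (dag f) := hf'.iso.isIso_hom
    have hc : (β_ (F.obj X) (F.obj X)).hom ≫ μ[F.obj X] = μ[F.obj X] := by
      rw [← cancel_epi (dag f ⊗ₘ dag f), BraidedCategory.braiding_naturality_assoc,
        ← IsMonHom.mul_hom, IsCommMonObj.mul_comm_assoc]
    have : IsCommMonObj X := ⟨F.map_injective (by
      rw [← cancel_epi (LaxMonoidal.μ F X X), F.map_comp, ← Functor.obj.μ_def, ← hc,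
        Functor.obj.μ_def, Functor.map_braiding]
      simp)⟩
    exact ⟨⟨X, hX⟩, ⟨ClassicalStructure.mkIso hf.iso hm' hf.preservesInvolution
      hf'.preservesInvolution⟩⟩

/-- A dagger equivalence induces an equivalence between categories of classical structures. -/
noncomputable def classicalStructureEquivalence (hF : IsDaggerEquivalence F) :
    ClassicalStructure C ≌ ClassicalStructure D :=
  have := full_mapClassicalStructure hF
  have := faithful_mapClassicalStructure hF
  have := essSurj_mapClassicalStructure hF
  have : (mapClassicalStructure hF).IsEquivalence := { }
  (mapClassicalStructure hF).asEquivalence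

end Transport

end QuantumTopos

namespace QuantumTopos

/-! ### Gelfand theory of finite-dimensional commutative algebras -/

section Characters

variable {A : Type*} [CommRing A]

/-- A commutative ring is reduced if multiplication by every element has an adjoint multiplication
for some definite form. -/
lemma isReduced_of_form (B : A → A → ℂ) (hB : ∀ x, B x x = 0 → x = 0) (hB₀ : ∀ x, B x 0 = 0)
    (hsymm : ∀ x y, star (B x y) = B y x)
    (hadj : ∀ x, ∃ x', ∀ y z, B (x * y) z = B y (x' * z)) : IsReduced A := by
  rw [isReduced_iff_pow_one_lt 2 one_lt_two]
  intro x hx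
  obtain ⟨x', h'⟩ := hadj x
  -- `B(x'x, x'x) = B(x x' x, x) = B(x' x², x) = 0`; the last lines then use `B(x, x) = B(1, x'x) =
  -- 0`.
  have h₁ : x' * x = 0 := hB _ <| by
    rw [← hsymm, ← h', show x * (x' * x) = x' * x ^ 2 by ring, hx, mul_zero, ← hsymm, hB₀,
      star_zero, star_zero]
  refine hB _ ?_
  rw [← mul_one x, h', mul_one, h₁, hB₀]

variable [Algebra ℂ A] [FiniteDimensional ℂ A]

/-- Characters separate the points of a finite-dimensional reduced commutative algebra. -/
lemma eq_of_characters_eq [IsReduced A] {a b : A} (h : ∀ χ : A →ₐ[ℂ] ℂ, χ a = χ b) : a = b := by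
  have : IsArtinianRing A := IsArtinianRing.of_finite ℂ A
  rw [← sub_eq_zero]
  -- A reduced Artinian ring is the product of its residue fields. Each is a finite extension of
  -- `ℂ`, hence `ℂ` itself, so the projections are characters.
  apply (IsArtinianRing.equivPi A).injective
  ext I
  rw [map_zero, IsArtinianRing.equivPi_apply, Pi.zero_apply]
  have := I.isMaximal
  let : Field (A ⧸ I.asIdeal) := Ideal.Quotient.field _
  have hbij : Function.Bijective (algebraMap ℂ (A ⧸ I.asIdeal)) :=
    IsAlgClosed.algebraMap_bijective_of_isIntegral
  let e : ℂ ≃ₐ[ℂ] (A ⧸ I.asIdeal) := AlgEquiv.ofBijective (Algebra.ofId ℂ _) hbij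
  have := h ((e.symm : (A ⧸ I.asIdeal) →ₐ[ℂ] ℂ).comp (Ideal.Quotient.mkₐ ℂ I.asIdeal))
  simpa [sub_eq_zero] using this

/-- The Gelfand transform of a finite-dimensional algebra is surjective. -/
lemma exists_forall_character_apply_eq (f : (A →ₐ[ℂ] ℂ) → ℂ) :
    ∃ a : A, ∀ χ : A →ₐ[ℂ] ℂ, χ a = f χ := by
  classical
  have := Fintype.ofFinite (A →ₐ[ℂ] ℂ)
  let T : A →ₗ[ℂ] ((A →ₐ[ℂ] ℂ) → ℂ) := LinearMap.pi fun χ => χ.toLinearMap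
  suffices h : LinearMap.range T = ⊤ by
    obtain ⟨a, ha⟩ := LinearMap.range_eq_top.1 h f
    exact ⟨a, fun χ => congrFun ha χ⟩
  by_contra hT
  obtain ⟨φ, hφ, hφT⟩ := Submodule.exists_le_ker_of_lt_top _ (lt_top_iff_ne_top.2 hT)
  -- A functional vanishing on the range is a linear relation between distinct characters, which
  -- Dedekind independence forbids unless it is trivial.
  have hli := Fintype.linearIndependent_iff.1 (linearIndependent_algHom_toLinearMap ℂ A ℂ)
    (fun χ => φ (Pi.single χ 1)) (by
      ext a
      have h₁ : φ (T a) = 0 := hφT (LinearMap.mem_range_self T a)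
      rw [← LinearMap.sum_single_apply _ (T a), map_sum] at h₁
      rw [LinearMap.sum_apply, LinearMap.zero_apply, ← h₁]
      refine Finset.sum_congr rfl fun χ _ => ?_
      have : Pi.single χ (T a χ) = T a χ • (Pi.single χ 1 : (A →ₐ[ℂ] ℂ) → ℂ) := by
        rw [← Pi.single_smul', smul_eq_mul, mul_one]
      rw [this, map_smul]
      simp [T, mul_comm])
  refine hφ (LinearMap.pi_ext' fun χ => LinearMap.ext_ring ?_)
  simpa using hli χ

end Characters

end QuantumTopos

namespace QuantumTopos

open DaggerCategory
open scoped MonObj TensorProduct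

variable {G : Type u} [Groupoid.{v} G]

/-! ### Fibers of a classical structure as algebras -/

namespace HilbRep

/-- The value at `x` of a unitary representation `A`. A monoid structure on `A` makes it a
complex algebra. -/
def Fiber (A : HilbRep G) (x : G) : Type := A.obj.obj x

noncomputable instance (A : HilbRep G) (x : G) : AddCommGroup (Fiber A x) :=
  inferInstanceAs (AddCommGroup (A.obj.obj x))

noncomputable instance (A : HilbRep G) (x : G) : Module ℂ (Fiber A x) :=
  inferInstanceAs (Module ℂ (A.obj.obj x))

instance (A : HilbRep G) (x : G) : FiniteDimensional ℂ (Fiber A x) :=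
  inferInstanceAs (FiniteDimensional ℂ (A.obj.obj x))

/-- The inner product on the fibers. -/
noncomputable def fiberInner (A : HilbRep G) (x : G) (a b : Fiber A x) : ℂ :=
  inner ℂ (E := A.obj.obj x) a b

/-- The multiplication on the fibers of a monoid. -/
noncomputable def fiberMul (A : HilbRep G) [MonObj A] (x : G) :
    A.obj.obj x ⊗[ℂ] A.obj.obj x →L[ℂ] A.obj.obj x :=
  (μ[A].hom.app x).hom

/-- The unit of the fibers of a monoid. -/
noncomputable def fiberOne (A : HilbRep G) [MonObj A] (x : G) : ℂ →L[ℂ] A.obj.obj x :=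
  (η[A].hom.app x).hom

variable (A : HilbRep G) [MonObj A] (x : G)

lemma fiberMul_one_left (a : A.obj.obj x) : fiberMul A x (fiberOne A x 1 ⊗ₜ[ℂ] a) = a :=
  (congrArg (fun k => (k.hom.app x).hom ((1 : ℂ) ⊗ₜ[ℂ] a)) (MonObj.one_mul A)).trans
    (one_smul ℂ a)

lemma fiberMul_comm [IsCommMonObj A] (a b : A.obj.obj x) :
    fiberMul A x (a ⊗ₜ[ℂ] b) = fiberMul A x (b ⊗ₜ[ℂ] a) :=
  congrArg (fun k => (k.hom.app x).hom (b ⊗ₜ[ℂ] a)) (IsCommMonObj.mul_comm A)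

lemma fiberMul_assoc (a b c : A.obj.obj x) :
    fiberMul A x (fiberMul A x (a ⊗ₜ[ℂ] b) ⊗ₜ[ℂ] c) =
      fiberMul A x (a ⊗ₜ[ℂ] fiberMul A x (b ⊗ₜ[ℂ] c)) :=
  congrArg (fun k => (k.hom.app x).hom ((a ⊗ₜ[ℂ] b) ⊗ₜ[ℂ] c)) (MonObj.mul_assoc A)

noncomputable instance [IsCommMonObj A] : CommRing (Fiber A x) where
  mul a b := fiberMul A x (a ⊗ₜ[ℂ] b)
  one := fiberOne A x 1
  mul_assoc := fiberMul_assoc A x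
  mul_comm := fiberMul_comm A x
  one_mul := fiberMul_one_left A x
  mul_one a := (fiberMul_comm A x _ _).trans (fiberMul_one_left A x a)
  left_distrib a b c := (congrArg (fiberMul A x) (TensorProduct.tmul_add a b c)).trans
    (map_add (fiberMul A x) _ _)
  right_distrib a b c := (congrArg (fiberMul A x) (TensorProduct.add_tmul a b c)).trans
    (map_add (fiberMul A x) _ _)
  zero_mul a := (congrArg (fiberMul A x) (TensorProduct.zero_tmul _ a)).trans
    (map_zero (fiberMul A x))
  mul_zero a := (congrArg (fiberMul A x) (TensorProduct.tmul_zero _ a)).trans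
    (map_zero (fiberMul A x))
  zsmul := fun n a => n • a
  zsmul_zero' := SubNegMonoid.zsmul_zero'
  zsmul_succ' := SubNegMonoid.zsmul_succ'
  zsmul_neg' := SubNegMonoid.zsmul_neg'
  nsmul := fun n a => n • a
  nsmul_zero := AddMonoid.nsmul_zero
  nsmul_succ := AddMonoid.nsmul_succ
  neg_add_cancel := neg_add_cancel
  sub_eq_add_neg := sub_eq_add_neg

noncomputable instance [IsCommMonObj A] : Algebra ℂ (Fiber A x) :=
  Algebra.ofModule
    (fun r (a b : A.obj.obj x) =>
      (congrArg (fiberMul A x) (TensorProduct.smul_tmul' r a b)).symm.trans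
        (map_smul (fiberMul A x) r _))
    (fun r (a b : A.obj.obj x) => (congrArg (fiberMul A x) (TensorProduct.tmul_smul r a b)).trans
      (map_smul (fiberMul A x) r _))

instance [IsCommMonObj A] : FiniteDimensional ℂ (Fiber A x) :=
  inferInstanceAs (FiniteDimensional ℂ (A.obj.obj x))

variable {A} [IsCommMonObj A]

/-- Multiplication by an element of a fiber has as its adjoint multiplication by some element. -/
lemma exists_adjoint_mul (hA : IsDaggerFrobenius A) (a : Fiber A x) :
    ∃ a' : Fiber A x, ∀ b c, fiberInner A x (a * b) c = fiberInner A x b (a' * c) := by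
  -- For `t = ∑ p ⊗ q` the element is `a' = ∑ ⟨a, p⟩ q`, got by contracting the first leg of `t`
  -- against `a`.
  have key (a : A.obj.obj x) (t : A.obj.obj x ⊗[ℂ] A.obj.obj x) :
      ∃ a' : A.obj.obj x, ∀ b c : A.obj.obj x,
      inner ℂ (a ⊗ₜ[ℂ] b)
        ((fiberMul A x).lTensor (A.obj.obj x) (TensorProduct.assoc ℂ _ _ _ (t ⊗ₜ[ℂ] c))) =
      inner ℂ b (fiberMul A x (a' ⊗ₜ[ℂ] c)) := by
    induction t with
    | zero => exact ⟨0, fun b c => by simp⟩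
    | tmul p q => exact ⟨inner ℂ a p • q, fun b c => by
        rw [TensorProduct.assoc_tmul, ContinuousLinearMap.lTensor_tmul, TensorProduct.inner_tmul,
          ← TensorProduct.smul_tmul', map_smul, inner_smul_right]⟩
    | add s t hs ht =>
      obtain ⟨a₁, h₁⟩ := hs
      obtain ⟨a₂, h₂⟩ := ht
      exact ⟨a₁ + a₂, fun b c => by
        rw [TensorProduct.add_tmul, map_add, map_add, inner_add_right, h₁, h₂,
          TensorProduct.add_tmul, map_add, inner_add_right]⟩
  obtain ⟨a', h⟩ := key a (ContinuousLinearMap.adjoint (fiberMul A x) (fiberOne A x 1))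
  refine ⟨a', fun b c => Eq.trans ?_ (h b c)⟩
  -- The Frobenius law at `1 ⊗ c` gives `(id ⊗ m)(m†(1) ⊗ c) = m†(c)`, so pairing with `a ⊗ b`
  -- yields `⟨ab, c⟩`.
  have hl : (fiberMul A x).lTensor (A.obj.obj x) (TensorProduct.assoc ℂ _ _ _
      (ContinuousLinearMap.adjoint (fiberMul A x) (fiberOne A x 1) ⊗ₜ[ℂ] c)) =
      ContinuousLinearMap.adjoint (fiberMul A x) (fiberMul A x (fiberOne A x 1 ⊗ₜ[ℂ] c)) :=
    congrArg (fun k => (k.hom.app x).hom (fiberOne A x 1 ⊗ₜ[ℂ] c)) hA.left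
  rw [hl, ContinuousLinearMap.adjoint_inner_right]
  exact congrArg (inner ℂ (fiberMul A x _)) (fiberMul_one_left A x c).symm

lemma isReduced_fiber (hA : IsDaggerFrobenius A) : IsReduced (Fiber A x) :=
  isReduced_of_form (fiberInner A x) (fun _ => (inner_self_eq_zero (𝕜 := ℂ) (E := A.obj.obj x)).1)
    (fun _ => inner_zero_right _) (fun a b => inner_conj_symm (E := A.obj.obj x) b a)
    (exists_adjoint_mul x hA)

variable {x}

/-- Characters of the fibers are compatible with adjoints. -/
lemma character_adjoint (hA : IsDaggerFrobenius A) (χ : Fiber A x →ₐ[ℂ] ℂ) {a a' : Fiber A x}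
    (h : ∀ b c, fiberInner A x (a * b) c = fiberInner A x b (a' * c)) : χ a' = star (χ a) := by
  classical
  have := isReduced_fiber x hA
  -- `e` is the minimal idempotent of `χ`, a common eigenvector of all multiplications. Comparing
  -- `⟨ae, e⟩` with `⟨e, a'e⟩` gives the claim after cancelling `⟨e, e⟩`.
  obtain ⟨e, he⟩ := exists_forall_character_apply_eq (A := Fiber A x) (Pi.single χ 1)
  have hmul (b : Fiber A x) : b * e = χ b • e := eq_of_characters_eq fun ψ => by
    rw [map_mul, map_smul, he]
    by_cases hψ : ψ = χ
    · subst hψ; simp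
    · simp [Pi.single_eq_of_ne hψ]
  have he0 : fiberInner A x e e ≠ 0 := fun h0 => by
    have : e = 0 := (inner_self_eq_zero (𝕜 := ℂ) (E := A.obj.obj x)).1 h0
    simpa [this] using he χ
  have h₁ := h e e
  rw [hmul, hmul] at h₁
  refine mul_right_cancel₀ he0 (Eq.trans ?_ (h₁.symm.trans ?_))
  · exact (inner_smul_right (𝕜 := ℂ) (E := A.obj.obj x) e e _).symm
  · exact inner_smul_left (𝕜 := ℂ) (E := A.obj.obj x) e e _

/-- The action of a morphism of `G` on the fibers of a monoid. -/
noncomputable def transport (A : HilbRep G) [MonObj A] [IsCommMonObj A] {x y : G} (g : x ⟶ y) :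
    Fiber A x →ₐ[ℂ] Fiber A y :=
  AlgHom.ofLinearMap ((A.obj.map g).hom : A.obj.obj x →ₗ[ℂ] A.obj.obj y)
    (congrArg (fun k => k.hom (1 : ℂ)) (η[A].hom.naturality g)).symm
    (fun a b => (congrArg (fun k => k.hom
      ((show A.obj.obj x from a) ⊗ₜ[ℂ] (show A.obj.obj x from b)))
      (μ[A].hom.naturality g)).symm)

/-- The action of a homomorphism of monoids on the fibers. -/
noncomputable def fiberMap {B : HilbRep G} [MonObj B] [IsCommMonObj B] (f : A ⟶ B) (hf : IsMonHom f)
    (x : G) : Fiber A x →ₐ[ℂ] Fiber B x :=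
  AlgHom.ofLinearMap ((f.hom.app x).hom : A.obj.obj x →ₗ[ℂ] B.obj.obj x)
    (congrArg (fun k => (k.hom.app x).hom (1 : ℂ)) hf.one_hom)
    (fun a b => congrArg (fun k => (k.hom.app x).hom
      ((show A.obj.obj x from a) ⊗ₜ[ℂ] (show A.obj.obj x from b))) hf.mul_hom)

lemma transport_id (A : HilbRep G) [MonObj A] [IsCommMonObj A] (x : G) :
    transport A (𝟙 x) = AlgHom.id ℂ _ := by
  ext a
  exact congrArg (fun k => k.hom a) (A.obj.map_id x)

lemma transport_comp (A : HilbRep G) [MonObj A] [IsCommMonObj A] {x y z : G} (g : x ⟶ y)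
    (h : y ⟶ z) : transport A (g ≫ h) = (transport A h).comp (transport A g) := by
  ext a
  exact congrArg (fun k => k.hom a) (A.obj.map_comp g h)

lemma fiberMap_transport {B : HilbRep G} [MonObj B] [IsCommMonObj B] (f : A ⟶ B) (hf : IsMonHom f)
    {x y : G} (g : x ⟶ y) :
    (fiberMap f hf y).comp (transport A g) = (transport B g).comp (fiberMap f hf x) := by
  ext a
  exact congrArg (fun k => k.hom a) (f.hom.naturality g)

lemma hom_ext_tmul {V W U : Hilb} {f g : V ⊗ W ⟶ U}
    (h : ∀ (v : V) (w : W), f.hom (v ⊗ₜ[ℂ] w) = g.hom (v ⊗ₜ[ℂ] w)) : f = g :=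
  Hilb.hom_ext_linear (TensorProduct.ext' h)

/-- The counit of a dagger Frobenius monoid is the inner product with the unit. -/
lemma adjoint_fiberOne (A : HilbRep G) [MonObj A] (x : G) (a : A.obj.obj x) :
    ContinuousLinearMap.adjoint (fiberOne A x) a = inner ℂ (fiberOne A x 1) a := by
  rw [← ContinuousLinearMap.adjoint_inner_right]
  simp

/-- Homomorphisms between classical structures preserve the involution. -/
lemma preservesInvolution_of_isMonHom {B : HilbRep G} [MonObj B] [IsCommMonObj B]
    (hA : IsDaggerFrobenius A) (hB : IsDaggerFrobenius B) (f : A ⟶ B) (hf : IsMonHom f) :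
    PreservesInvolution f := by
  rw [preservesInvolution_iff]
  ext x : 3
  refine hom_ext_tmul fun b a => ?_
  obtain ⟨a', ha'⟩ := exists_adjoint_mul x hA a
  obtain ⟨b', hb'⟩ := exists_adjoint_mul x hB (fiberMap f hf x a)
  have := isReduced_fiber x hB
  -- Every character takes the value `conj (χ (f a))` on both sides. The criterion then reads `⟨b',
  -- b⟩ = ⟨f a', b⟩ = ⟨a', f† b⟩`.
  have hab : fiberMap f hf x a' = b' := eq_of_characters_eq fun χ => by
    rw [character_adjoint hB χ hb', ← AlgHom.comp_apply, character_adjoint hA _ ha']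
    rfl
  have hA₁ (c : A.obj.obj x) :
      ContinuousLinearMap.adjoint (fiberOne A x) (fiberMul A x (c ⊗ₜ[ℂ] a)) =
        fiberInner A x a' c := by
    rw [adjoint_fiberOne, fiberMul_comm]
    refine (inner_conj_symm _ _).symm.trans ((congrArg star (ha' c 1)).trans ?_)
    rw [mul_one]
    exact inner_conj_symm _ _
  have hB₁ : ContinuousLinearMap.adjoint (fiberOne B x)
      (fiberMul B x (b ⊗ₜ[ℂ] (f.hom.app x).hom a)) =
        fiberInner B x b' b := by
    rw [adjoint_fiberOne, fiberMul_comm]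
    refine (inner_conj_symm _ _).symm.trans ((congrArg star (hb' b 1)).trans ?_)
    rw [mul_one]
    exact inner_conj_symm _ _
  refine hB₁.trans (Eq.trans ?_ (hA₁ (ContinuousLinearMap.adjoint (f.hom.app x).hom b)).symm)
  rw [← hab]
  exact (ContinuousLinearMap.adjoint_inner_right (f.hom.app x).hom a' b).symm

/-- A family of algebra homomorphisms between fibers that commutes with the action of `G` comes from
a homomorphism of monoids. -/
lemma exists_fiberMap_eq {B : HilbRep G} [MonObj B] [IsCommMonObj B]
    (φ : ∀ x, Fiber A x →ₐ[ℂ] Fiber B x)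
    (hφ : ∀ ⦃x y : G⦄ (g : x ⟶ y), (φ y).comp (transport A g) = (transport B g).comp (φ x)) :
    ∃ (f : A ⟶ B) (hf : IsMonHom f), ∀ x, fiberMap f hf x = φ x := by
  let L (x : G) : A.obj.obj x →ₗ[ℂ] B.obj.obj x := (φ x).toLinearMap
  let f : A ⟶ B := ObjectProperty.homMk
    { app := fun x => ⟨LinearMap.toContinuousLinearMap (L x)⟩
      naturality := fun x y g => by
        ext a
        exact DFunLike.congr_fun (hφ g) a }
  have hf : IsMonHom f :=
    { one_hom := by
        ext x : 3
        refine Hilb.hom_ext_linear (LinearMap.ext_ring ?_)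
        exact (φ x).map_one
      mul_hom := by
        ext x : 3
        exact hom_ext_tmul fun a b => (φ x).map_mul a b }
  exact ⟨f, hf, fun x => rfl⟩

end HilbRep

end QuantumTopos

namespace QuantumTopos

open DaggerCategory
open scoped MonObj TensorProduct

variable {G : Type u} [Groupoid.{v} G]

/-! ### The functor of characters is fully faithful -/

open HilbRep

/-- The `G`-set of characters of the fibers of a classical structure. -/
noncomputable def characters (A : ClassicalStructure (HilbRep G)) : G ⥤ FintypeCat.{0} where
  obj x := FintypeCat.of (Fiber A.X x →ₐ[ℂ] ℂ)
  -- Precomposition reverses arrows; the inverse makes the action covariant.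
  map g := FintypeCat.homMk fun χ => χ.comp (transport A.X (Groupoid.inv g))
  map_id x := by
    refine FintypeCat.hom_ext _ _ fun χ => ?_
    change χ.comp (transport A.X (Groupoid.inv (𝟙 x))) = χ
    rw [Groupoid.inv_eq_inv, IsIso.inv_id, transport_id, AlgHom.comp_id]
  map_comp {x y z} g h := by
    refine FintypeCat.hom_ext _ _ fun χ => ?_
    change χ.comp (transport A.X (Groupoid.inv (g ≫ h))) =
      (χ.comp (transport A.X (Groupoid.inv g))).comp (transport A.X (Groupoid.inv h))
    rw [AlgHom.comp_assoc, ← transport_comp]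
    simp [Groupoid.inv_eq_inv]

variable (G) in
/-- The contravariant functor that sends a classical structure to the `G`-set of its characters. -/
noncomputable def charactersFunctor :
    (ClassicalStructure (HilbRep G))ᵒᵖ ⥤ (G ⥤ FintypeCat.{0}) where
  obj A := characters A.unop
  map f :=
    { app := fun x => FintypeCat.homMk fun χ => χ.comp (fiberMap f.unop.hom f.unop.isMonHom x)
      naturality := fun x y g => by
        ext χ
        exact congrArg χ.comp
          (fiberMap_transport f.unop.hom f.unop.isMonHom (Groupoid.inv g)).symm }
  map_id A := rfl
  map_comp f g := rfl

/-- Characters separate the points of the algebra in which the two homomorphisms take their values.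
-/
instance : (charactersFunctor G).Faithful where
  map_injective {A B} f g h := by
    apply Quiver.Hom.unop_inj
    apply ClassicalStructure.Hom.ext
    ext x a
    have := isReduced_fiber x A.unop.frobenius
    refine eq_of_characters_eq (A := Fiber A.unop.X x) fun χ => ?_
    have h₁ := ConcreteCategory.congr_hom (NatTrans.congr_app h x) χ
    exact DFunLike.congr_fun (F := Fiber B.unop.X x →ₐ[ℂ] ℂ) h₁ a

/-- A map between the sets of characters comes from an algebra homomorphism. -/
lemma exists_algHom_forall_character {A B : Type*} [CommRing A] [Algebra ℂ A] [CommRing B]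
    [Algebra ℂ B] [FiniteDimensional ℂ B] [IsReduced B] (τ : (B →ₐ[ℂ] ℂ) → (A →ₐ[ℂ] ℂ)) :
    ∃ φ : A →ₐ[ℂ] B, ∀ χ, χ.comp φ = τ χ := by
  -- `φ a` is the element whose Gelfand transform is `χ ↦ τ χ a`; since characters separate points,
  -- it is unique and `φ` inherits the algebra laws.
  choose φ hφ using fun a : A => exists_forall_character_apply_eq (A := B) fun χ => τ χ a
  refine ⟨AlgHom.ofLinearMap
    { toFun := φ
      map_add' := fun a b => eq_of_characters_eq fun χ => by simp [hφ]
      map_smul' := fun c a => eq_of_characters_eq fun χ => by simp [hφ] }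
    (eq_of_characters_eq fun χ => by simp [hφ])
    (fun a b => eq_of_characters_eq fun χ => by simp [hφ]), fun χ => ?_⟩
  ext a
  exact hφ a χ

instance : (charactersFunctor G).Full where
  map_surjective {B A} τ := by
    have hred (x : G) := isReduced_fiber x B.unop.frobenius
    choose φ hφ using fun x : G => exists_algHom_forall_character
      (A := Fiber A.unop.X x) (B := Fiber B.unop.X x) (τ.app x)
    obtain ⟨f, hf, h⟩ := exists_fiberMap_eq φ fun x y g => by
      ext a
      refine eq_of_characters_eq fun χ => ?_
      -- Naturality is used at `g⁻¹` because `G` acts on characters through inverses, so that `g`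
      -- itself acts on the algebras.
      have h₁ : τ.app x (χ.comp (transport B.unop.X (Groupoid.inv (Groupoid.inv g)))) =
          (τ.app y χ).comp (transport A.unop.X (Groupoid.inv (Groupoid.inv g))) :=
        ConcreteCategory.congr_hom (τ.naturality (Groupoid.inv g)) χ
      rw [show Groupoid.inv (Groupoid.inv g) = g by simp [Groupoid.inv_eq_inv], ← hφ, ← hφ] at h₁
      exact (DFunLike.congr_fun (F := Fiber A.unop.X x →ₐ[ℂ] ℂ) h₁ a).symm
    refine ⟨Quiver.Hom.op ⟨f, hf, preservesInvolution_of_isMonHom A.unop.frobenius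
      B.unop.frobenius f hf⟩, ?_⟩
    ext x χ
    refine Eq.trans ?_ (hφ x χ)
    rw [← h]
    rfl

end QuantumTopos

namespace QuantumTopos

open DaggerCategory
open scoped MonObj TensorProduct

/-! ### The algebra `ℓ²(S)` and its copying comultiplication -/

section Ell2

variable (S : Type*)

/-- Pointwise multiplication on `ℓ²(S)`. -/
noncomputable def ell2Mul :
    EuclideanSpace ℂ S ⊗[ℂ] EuclideanSpace ℂ S →ₗ[ℂ] EuclideanSpace ℂ S :=
  TensorProduct.lift (LinearMap.mk₂ ℂ (fun v w => WithLp.toLp 2 fun i => v i * w i)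
    (fun v v' w => by ext i; simp [add_mul]) (fun c v w => by ext i; simp [mul_assoc])
    (fun v w w' => by ext i; simp [mul_add]) (fun c v w => by ext i; simp [mul_left_comm]))

variable {S}

@[simp]
lemma ell2Mul_tmul_apply (v w : EuclideanSpace ℂ S) (i : S) :
    ell2Mul S (v ⊗ₜ[ℂ] w) i = v i * w i := rfl

lemma ell2Mul_single_left [DecidableEq S] (i : S) (w : EuclideanSpace ℂ S) :
    ell2Mul S (EuclideanSpace.single i (1 : ℂ) ⊗ₜ[ℂ] w) =
      w i • EuclideanSpace.single i (1 : ℂ) := by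
  ext j
  by_cases h : j = i
  · subst h; simp
  · simp [h]

lemma ell2Mul_comm (v w : EuclideanSpace ℂ S) :
    ell2Mul S (v ⊗ₜ[ℂ] w) = ell2Mul S (w ⊗ₜ[ℂ] v) := by
  ext i
  simp [mul_comm]

lemma ell2Mul_one_left (c : ℂ) (v : EuclideanSpace ℂ S) :
    ell2Mul S ((c • (WithLp.toLp 2 fun _ => 1 : EuclideanSpace ℂ S)) ⊗ₜ[ℂ] v) = c • v := by
  ext i
  simp

lemma ell2Mul_assoc (u v w : EuclideanSpace ℂ S) :
    ell2Mul S (ell2Mul S (u ⊗ₜ[ℂ] v) ⊗ₜ[ℂ] w) = ell2Mul S (u ⊗ₜ[ℂ] ell2Mul S (v ⊗ₜ[ℂ] w)) := by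
  ext i
  simp [mul_assoc]

variable [Fintype S]

variable (S) in
/-- The comultiplication on `ℓ²(S)` that copies the standard basis. -/
noncomputable def ell2Comul [DecidableEq S] :
    EuclideanSpace ℂ S →ₗ[ℂ] EuclideanSpace ℂ S ⊗[ℂ] EuclideanSpace ℂ S where
  toFun v := ∑ i, v i • (EuclideanSpace.single i (1 : ℂ) ⊗ₜ[ℂ] EuclideanSpace.single i (1 : ℂ))
  map_add' v w := by simp [add_smul, Finset.sum_add_distrib]
  map_smul' c v := by simp [mul_smul, Finset.smul_sum]

lemma ell2Comul_apply [DecidableEq S] (v : EuclideanSpace ℂ S) : ell2Comul S v =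
    ∑ i, v i • (EuclideanSpace.single i (1 : ℂ) ⊗ₜ[ℂ] EuclideanSpace.single i (1 : ℂ)) := rfl

/-- On `t = a ⊗ b` both sides are `∑ conj (v i) * a i * b i`. -/
lemma inner_ell2Comul [DecidableEq S] (v : EuclideanSpace ℂ S)
    (t : EuclideanSpace ℂ S ⊗[ℂ] EuclideanSpace ℂ S) :
    inner ℂ (ell2Comul S v) t = inner ℂ v (ell2Mul S t) := by
  induction t with
  | zero => simp
  | add s t hs ht => rw [inner_add_right, hs, ht, map_add, inner_add_right]
  | tmul a b =>
    simp only [ell2Comul_apply, sum_inner, TensorProduct.smul_tmul']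
    simp [inner_smul_left, PiLp.inner_apply, mul_comm, mul_left_comm, mul_assoc]

variable (S) in
lemma adjoint_ell2Mul [DecidableEq S]
    [CompleteSpace (EuclideanSpace ℂ S ⊗[ℂ] EuclideanSpace ℂ S)] :
    ContinuousLinearMap.adjoint (LinearMap.toContinuousLinearMap (ell2Mul S)) =
      LinearMap.toContinuousLinearMap (ell2Comul S) :=
  ((ContinuousLinearMap.eq_adjoint_iff _ _).2 inner_ell2Comul).symm

/-- Both sides equal `∑ v i * w i • (e i ⊗ e i)`, as does the mirror image below. -/
lemma lTensor_ell2Mul_comul [DecidableEq S] (v w : EuclideanSpace ℂ S) :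
    (ell2Mul S).lTensor _ (TensorProduct.assoc ℂ _ _ _ (ell2Comul S v ⊗ₜ[ℂ] w)) =
      ell2Comul S (ell2Mul S (v ⊗ₜ[ℂ] w)) := by
  simp [ell2Comul_apply, TensorProduct.sum_tmul, ← TensorProduct.smul_tmul', ell2Mul_single_left,
    TensorProduct.tmul_smul, mul_smul]

lemma rTensor_ell2Mul_comul [DecidableEq S] (v w : EuclideanSpace ℂ S) :
    (ell2Mul S).rTensor _ ((TensorProduct.assoc ℂ _ _ _).symm (v ⊗ₜ[ℂ] ell2Comul S w)) =
      ell2Comul S (ell2Mul S (v ⊗ₜ[ℂ] w)) := by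
  simp [ell2Comul_apply, TensorProduct.tmul_sum, TensorProduct.tmul_smul,
    ell2Mul_comm v (EuclideanSpace.single _ _), ell2Mul_single_left,
    ← TensorProduct.smul_tmul', smul_smul, mul_comm]

variable (S) in
-- The factor `(1 : ℂ) •` matches the unit of `ell2Rep`, which is a scalar map evaluated at `1`.
lemma sum_single_eq_one [DecidableEq S] :
    ∑ i, EuclideanSpace.single i (1 : ℂ) =
      (1 : ℂ) • (WithLp.toLp 2 fun _ => 1 : EuclideanSpace ℂ S) := by
  ext j
  simp

variable {T : Type*} [Fintype T]

/-- Precomposition with a map of finite sets. -/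
noncomputable def ell2Comap (f : S → T) : EuclideanSpace ℂ T →L[ℂ] EuclideanSpace ℂ S :=
  LinearMap.toContinuousLinearMap
    { toFun := fun v => WithLp.toLp 2 fun i => v (f i)
      map_add' := fun _ _ => rfl
      map_smul' := fun _ _ => rfl }

@[simp]
lemma ell2Comap_apply (f : S → T) (v : EuclideanSpace ℂ T) (i : S) :
    ell2Comap f v i = v (f i) := rfl

lemma adjoint_ell2Comap (e : S ≃ T) :
    ContinuousLinearMap.adjoint (ell2Comap e) = ell2Comap e.symm := by
  refine ((ContinuousLinearMap.eq_adjoint_iff _ _).2 fun v w => ?_).symm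
  simp only [PiLp.inner_apply, ell2Comap_apply]
  exact Fintype.sum_equiv e.symm _ _ (by simp)

end Ell2

/-! ### Permutation representations and essential surjectivity -/

section Ell2Rep

variable {G : Type u} [Groupoid.{v} G]

attribute [local instance] FintypeCat.fintype

/-- The Hilbert space `ℓ²(S)` of a finite set. -/
noncomputable def ell2 (S : FintypeCat.{0}) : Hilb := ⟨EuclideanSpace ℂ S⟩

/-- Precomposition with a map of sets. -/
noncomputable def ell2Map {S T : FintypeCat.{0}} (f : S → T) : ell2 T ⟶ ell2 S := ⟨ell2Comap f⟩

lemma ell2Map_comp {S T U : FintypeCat.{0}} (f : S ⟶ T) (g : T ⟶ U) :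
    ell2Map g ≫ ell2Map f = ell2Map (f ≫ g) := rfl

lemma dag_ell2Map {S T : FintypeCat.{0}} (e : S ≅ T) : dag (ell2Map e.hom) = ell2Map e.inv :=
  Hilb.hom_ext (adjoint_ell2Comap (FintypeCat.equivEquivIso.symm e))

/-- The permutation representation on `ℓ²` of a `G`-set. -/
noncomputable def ell2Rep (X : G ⥤ FintypeCat.{0}) : HilbRep G where
  obj :=
    { obj := fun x => ell2 (X.obj x)
      map := fun g => ell2Map (X.map (Groupoid.inv g))
      map_id := fun x => by
        rw [Groupoid.inv_eq_inv, IsIso.inv_id, X.map_id]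
        rfl
      map_comp := fun g h => by
        rw [ell2Map_comp, ← X.map_comp]
        simp [Groupoid.inv_eq_inv] }
  property x y g := by
    change ell2Map (X.map _) = dag (ell2Map (X.map (Groupoid.inv g)))
    have := dag_ell2Map (X.mapIso (asIso (Groupoid.inv g)))
    refine Eq.trans ?_ this.symm
    simp [Groupoid.inv_eq_inv]

noncomputable instance (X : G ⥤ FintypeCat.{0}) : MonObj (ell2Rep X) where
  one := ObjectProperty.homMk
    { app := fun x => ⟨ContinuousLinearMap.toSpanSingleton ℂ (M₁ := EuclideanSpace ℂ (X.obj x))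
        (WithLp.toLp 2 fun _ => 1)⟩
      naturality := fun x y g => Hilb.hom_ext_linear (LinearMap.ext_ring rfl) }
  mul := ObjectProperty.homMk
    { app := fun x => ⟨LinearMap.toContinuousLinearMap (ell2Mul (X.obj x))⟩
      naturality := fun x y g => HilbRep.hom_ext_tmul fun v w => rfl }
  one_mul := by
    ext x : 3
    exact HilbRep.hom_ext_tmul ell2Mul_one_left
  mul_one := by
    ext x : 3
    exact HilbRep.hom_ext_tmul fun v c => (ell2Mul_comm _ _).trans (ell2Mul_one_left c v)
  mul_assoc := by
    ext x : 3
    exact Hilb.hom_ext_linear (TensorProduct.ext_threefold ell2Mul_assoc)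

instance (X : G ⥤ FintypeCat.{0}) : IsCommMonObj (ell2Rep X) where
  mul_comm := by
    ext x : 3
    exact HilbRep.hom_ext_tmul fun v w => ell2Mul_comm w v

/-- The adjoint of pointwise multiplication copies the standard basis, so the fiberwise identities
for `ell2Comul` apply. -/
lemma isDaggerFrobenius_ell2Rep (X : G ⥤ FintypeCat.{0}) : IsDaggerFrobenius (ell2Rep X) := by
  classical
  have h (x : G) (v : (ell2Rep X).obj.obj x) :
      ((dag μ[ell2Rep X]).hom.app x).hom v = ell2Comul (X.obj x) v :=
    DFunLike.congr_fun (adjoint_ell2Mul (X.obj x)) v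
  constructor
  · ext x : 3
    refine HilbRep.hom_ext_tmul fun v w => ?_
    refine Eq.trans ?_ ((lTensor_ell2Mul_comul v w).trans
      (h x (ell2Mul (X.obj x) (v ⊗ₜ[ℂ] w))).symm)
    exact (ContinuousLinearMap.lTensor_apply (E := (ell2Rep X).obj.obj x)
      (μ[ell2Rep X].hom.app x).hom _).trans (congrArg (fun t => (ell2Mul (X.obj x)).lTensor
        (EuclideanSpace ℂ (X.obj x)) (TensorProduct.assoc ℂ _ _ _ (t ⊗ₜ[ℂ] w))) (h x v))
  · ext x : 3
    refine HilbRep.hom_ext_tmul fun v w => ?_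
    refine Eq.trans ?_ ((rTensor_ell2Mul_comul v w).trans
      (h x (ell2Mul (X.obj x) (v ⊗ₜ[ℂ] w))).symm)
    exact congrArg (fun t => (ell2Mul (X.obj x)).rTensor _
      ((TensorProduct.assoc ℂ _ _ _).symm (v ⊗ₜ[ℂ] t))) (h x w)

/-- The classical structure on `ℓ²` of a `G`-set. -/
noncomputable def ell2ClassicalStructure (X : G ⥤ FintypeCat.{0}) :
    ClassicalStructure (HilbRep G) :=
  ⟨ell2Rep X, isDaggerFrobenius_ell2Rep X⟩

/-- The evaluation character. -/
noncomputable def ell2Eval (X : G ⥤ FintypeCat.{0}) (x : G) (i : X.obj x) :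
    HilbRep.Fiber (ell2Rep X) x →ₐ[ℂ] ℂ :=
  AlgHom.ofLinearMap
    { toFun := fun v : EuclideanSpace ℂ (X.obj x) => v i
      map_add' := fun _ _ => rfl
      map_smul' := fun _ _ => rfl }
    (one_mul (1 : ℂ)) (fun _ _ => rfl)

lemma bijective_ell2Eval (X : G ⥤ FintypeCat.{0}) (x : G) :
    Function.Bijective (ell2Eval X x) := by
  classical
  let e (i : X.obj x) : HilbRep.Fiber (ell2Rep X) x :=
    (EuclideanSpace.single i (1 : ℂ) : EuclideanSpace ℂ (X.obj x))
  have he (i : X.obj x) (v : HilbRep.Fiber (ell2Rep X) x) : e i * v = ell2Eval X x i v • e i :=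
    ell2Mul_single_left i (v : EuclideanSpace ℂ (X.obj x))
  have hsum : ∑ i, e i = 1 := sum_single_eq_one (X.obj x)
  constructor
  -- The basis vector `e i` distinguishes evaluation at `i` from evaluation at `j ≠ i`.
  · intro i j h
    by_contra hij
    have := DFunLike.congr_fun h (e i)
    have h₁ : (EuclideanSpace.single i (1 : ℂ) : EuclideanSpace ℂ (X.obj x)) i =
      (EuclideanSpace.single i (1 : ℂ) : EuclideanSpace ℂ (X.obj x)) j := this
    simp [Ne.symm hij] at h₁
  · intro χ
    -- Since `∑ e i = 1`, not all `χ (e i)` vanish. Applying `χ` to `e i * v = v i • e i` and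
    -- cancelling gives `χ v = v i`.
    have h₁ : ∃ i, χ (e i) ≠ 0 := by
      by_contra! h₀
      simpa [h₀] using congrArg χ hsum
    obtain ⟨i, hi⟩ := h₁
    refine ⟨i, AlgHom.ext fun v => ?_⟩
    have := congrArg χ (he i v)
    rw [map_mul, map_smul, smul_eq_mul, mul_comm] at this
    exact (mul_right_cancel₀ hi this).symm

instance : (charactersFunctor G).EssSurj where
  mem_essImage X := ⟨Opposite.op (ell2ClassicalStructure X), ⟨(NatIso.ofComponents
    (fun x => FintypeCat.equivEquivIso (Equiv.ofBijective _ (bijective_ell2Eval X x)))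
    fun {x y} g => by
      refine FintypeCat.hom_ext _ _ fun i => AlgHom.ext fun (v : EuclideanSpace ℂ (X.obj y)) => ?_
      -- One inverse comes from the action on functions and one from the action on characters; they
      -- cancel.
      change v (X.map g i) = v (X.map (Groupoid.inv (Groupoid.inv g)) i)
      simp [Groupoid.inv_eq_inv]).symm⟩⟩

variable (G) in
/-- The category of classical structures in `Hilb^G` is dual to the category of finite `G`-sets. -/
noncomputable def charactersEquivalence :
    (ClassicalStructure (HilbRep G))ᵒᵖ ≌ (G ⥤ FintypeCat.{0}) :=
  have : (charactersFunctor G).IsEquivalence := { }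
  (charactersFunctor G).asEquivalence

lemma isDaggerEquivalence_id (C : Type u) [Category.{v} C] [MonoidalCategory C]
    [SymmetricCategory C] [DaggerCategory C] : IsDaggerEquivalence (𝟭 C) where
  map_dag _ := rfl
  unitary_ε := by simp [IsUnitary, dag_id]
  unitary_μ X Y := by simp [IsUnitary, dag_id]
  full := inferInstance
  faithful := inferInstance
  unitarily_essSurj Y := ⟨Y, 𝟙 Y, by simp [IsUnitary, dag_id]⟩

end Ell2Rep

end QuantumTopos

/-! ### The duality theorem -/

theorem mainTheorem4 :
    -- the classical structures of a finite quantum Boolean topos form the opposite of a finite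
    -- Boolean topos, whatever duals are chosen to express preservation of the involution
    (∀ (Q : Type u) [Category.{v} Q] [MonoidalCategory Q] [SymmetricCategory Q]
        [QuantumTopos.DaggerCategory Q] [QuantumTopos.SymmetricMonoidalDaggerCategory Q],
      QuantumTopos.IsFiniteQuantumBooleanTopos Q →
        Nonempty (LeftRigidCategory Q) ∧
        ∀ [LeftRigidCategory Q],
          QuantumTopos.IsFiniteBooleanTopos (QuantumTopos.ClassicalStructure Q)ᵒᵖ) ∧
    -- more precisely, the groupoid is the same on both sides
    (∀ (G : Type) [Groupoid.{0} G] [Finite G] [∀ x y : G, Finite (x ⟶ y)]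
        (Q : Type u) [Category.{v} Q] [MonoidalCategory Q] [SymmetricCategory Q]
        [QuantumTopos.DaggerCategory Q] [QuantumTopos.SymmetricMonoidalDaggerCategory Q]
        [LeftRigidCategory Q] (F : Q ⥤ QuantumTopos.HilbRep G) [F.Braided],
      QuantumTopos.IsDaggerEquivalence F →
        Nonempty ((QuantumTopos.ClassicalStructure Q)ᵒᵖ ≌ (G ⥤ FintypeCat.{0}))) ∧
    (∀ (G : Type) [Groupoid.{0} G] [Finite G] [∀ x y : G, Finite (x ⟶ y)],
      QuantumTopos.IsFiniteQuantumBooleanTopos (QuantumTopos.HilbRep G) ∧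
        Nonempty ((QuantumTopos.ClassicalStructure (QuantumTopos.HilbRep G))ᵒᵖ ≌
          (G ⥤ FintypeCat.{0}))) ∧
    -- every finite Boolean topos arises in this way
    (∀ (T : Type u') [Category.{v'} T], QuantumTopos.IsFiniteBooleanTopos T →
      ∃ (G : Type) (_ : Groupoid.{0} G) (_ : Finite G) (_ : ∀ x y : G, Finite (x ⟶ y)),
        QuantumTopos.IsFiniteQuantumBooleanTopos (QuantumTopos.HilbRep G) ∧
        Nonempty ((QuantumTopos.ClassicalStructure (QuantumTopos.HilbRep G))ᵒᵖ ≌ T)) := by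
  refine ⟨fun Q => ?_, fun G => ?_, fun G => ?_, fun T => ?_⟩
  · intro _ _ _ _ _ ⟨G, _, hG, hG', F, _, hF⟩
    refine ⟨hF.nonempty_leftRigidCategory, ?_⟩
    intro _
    -- Transport to `Hilb^G` followed by Gelfand duality there, for whichever duals were chosen in
    -- `Q`.
    exact ⟨G, inferInstance, hG, hG', ⟨(QuantumTopos.classicalStructureEquivalence hF).op.trans
      (QuantumTopos.charactersEquivalence G)⟩⟩
  · intro _ _ _ Q _ _ _ _ _ _ F _ hF
    exact ⟨(QuantumTopos.classicalStructureEquivalence hF).op.trans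
      (QuantumTopos.charactersEquivalence G)⟩
  · intro _ hG hG'
    exact ⟨⟨G, inferInstance, hG, hG', 𝟭 _, inferInstance,
      QuantumTopos.isDaggerEquivalence_id _⟩, ⟨QuantumTopos.charactersEquivalence G⟩⟩
  · intro _ ⟨G, _, hG, hG', ⟨e⟩⟩
    exact ⟨G, inferInstance, hG, hG', ⟨G, inferInstance, hG, hG', 𝟭 _, inferInstance,
      QuantumTopos.isDaggerEquivalence_id _⟩, ⟨(QuantumTopos.charactersEquivalence G).trans e.symm⟩⟩
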